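/- All manifolds are smooth, real, finite-dimensional, Hausdorff, second countable and connected, and all maps are smooth. Let $\pi:Y\to X$ be a fiber bundle with $\dim X=n$ and adapted coordinates $(x^\lambda,y^i)$; put $\omega=dx^1\wedge\dots\wedge dx^n$, $\omega_\lambda=\partial_\lambda\rfloor\omega$. Let $J^1Y\to Y$ be the affine bundle of first jets of sections, with coordinates $(x^\lambda,y^i,y^i_\lambda)$, and let $\Pi=\bigwedge^nT^*X\otimes_Y V^*Y\otimes_Y TX$ be the Legendre bundle, with coordinates $(x^\lambda,y^i,p^\lambda_i)$ and projection $\pi_{\Pi Y}:\Pi\to Y$. Let $L=\mathcal L\,\omega:J^1Y\to\bigwedge^nT^*X$ be a first order Lagrangian, $\pi^\lambda_i=\partial\mathcal L/\partial y^i_\lambda$, let $\widehat L:J^1Y\to\Pi$, $p^\lambda_i\circ\widehat L=\pi^\lambda_i$, be its Legendre map, and $N_L=\widehat L(J^1Y)$. The Lagrangian $L$ is *semiregular* if $\widehat L^{-1}(q)$ is a connected submanifold of $J^1Y$ for every $q\in N_L$. Let $Z_Y=T^*Y\wedge(\bigwedge^{n-1}T^*X)$, which is the bundle of affine maps from the fibers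 of $J^1Y\to Y$ to $\bigwedge^nT^*X$, and let $Z_Y\to\Pi$ be the projection onto the linear part. A *Hamiltonian form* is $H=p^\lambda_i\,dy^i\wedge\omega_\lambda-\mathcal H\,\omega$ on $\Pi$, given by a global section of $Z_Y\to\Pi$. It defines the Hamiltonian map $\widehat H:\Pi\to J^1Y$ over $Y$, $y^i_\lambda\circ\widehat H=\partial\mathcal H/\partial p^\lambda_i$. The form $H$ is *associated* with $L$ if $$\widehat L\circ\widehat H\circ\widehat L=\widehat L,\qquad H=H_{\widehat H}+\widehat H^*L,$$ where $H_{\Phi}=p^\lambda_i\,dy^i\wedge\omega_\lambda-p^\lambda_i\Phi^i_\lambda\,\omega$ for a bundle morphism $\Phi:\Pi\to J^1Y$ over $Y$. **Theorem.** Let $L$ be a semiregular Lagrangian, $H$ a Hamiltonian form associated with $L$, and $r:X\to\Pi$ a section which solves the covariant Hamilton equations for $H$, $$\partial_\lambda r^i=\frac{\partial\mathcal H}{\partial p^\lambda_i}\circ r,\qquad \sum_\lambda\partial_\lambda r^\lambda_i=-\frac{\partial\mathcal H}{\partial y^i}\circ r,$$ where $r^i=y^i\circ r$, $r^\lambda_i=p^\lambda_i\circ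 r$. Suppose that $r(X)\subset N_L$. Then the section $s=\pi_{\Pi Y}\circ r$ of $Y\to X$ satisfies the Euler–Lagrange equations $$\Big(\frac{\partial}{\partial y^i}-d_\lambda\frac{\partial}{\partial y^i_\lambda}\Big)\mathcal L=0,\qquad d_\lambda=\partial_\lambda+y^i_\lambda\partial_i+y^i_{\lambda\mu}\partial^\mu_i,$$ and the section $\overline s=\widehat H\circ r$ of $J^1Y\to X$ satisfies the Cartan equations $$\frac{\partial\pi^\mu_j}{\partial y^i_\lambda}(\widehat y^j_\mu-y^j_\mu)=0,\qquad \frac{\partial\mathcal L}{\partial y^i}-\widehat d_\lambda\pi^\lambda_i+(\widehat y^j_\lambda-y^j_\lambda)\frac{\partial\pi^\lambda_j}{\partial y^i}=0,\qquad \widehat d_\lambda=\partial_\lambda+\widehat y^i_\lambda\partial_i+y^i_{\lambda\mu}\partial^\mu_i,$$ where $(x^\lambda,y^i,y^i_\lambda,\widehat y^i_\lambda,y^i_{\lambda\mu})$ are the coordinates of $J^1J^1Y$, evaluated on the first jet of $\overline s$: $y^i=\overline s^i$, $y^i_\lambda=\overline s^i_\lambda$, $\widehat y^i_\lambda=\partial_\lambda\overline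 s^i$, $y^i_{\lambda\mu}=\partial_\lambda\overline s^i_\mu$. -/

import Mathlib

open scoped Manifold ContDiff
open Module

noncomputable section

namespace CovariantHamilton

/-! ### Model spaces and coordinate spaces -/

/-- `ℝᵏ`. -/
abbrev Euc (k : ℕ) : Type := EuclideanSpace ℝ (Fin k)

/-- Coordinates `(x^λ, y^i, y^i_λ)` on the jet bundle; the last component is `i ↦ λ ↦ y^i_λ`. -/
abbrev JetCoord (n m : ℕ) : Type := Euc n × Euc m × (Fin m → Fin n → ℝ)

/-- Coordinates `(x^λ, y^i, p^λ_i)` on the Legendre bundle; the last component is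
`λ ↦ i ↦ p^λ_i`. -/
abbrev MomCoord (n m : ℕ) : Type := Euc n × Euc m × (Fin n → Fin m → ℝ)

/-- The space `⋀ⁿ T*_x X`. Mathlib's tangent space `TangentSpace 𝓘(ℝ, Euc n) x` of an
`n`-dimensional manifold is, by definition, a copy of `Euc n`; here and below the tangent spaces
`T_x X` and `T_y Y` are written as `Euc n` and `Euc n × Euc m`. -/
abbrev TopForm (n : ℕ) : Type := Euc n [⋀^Fin n]→L[ℝ] ℝ

/-- The standard volume form `dx^1 ∧ ⋯ ∧ dx^n` of `ℝⁿ`. -/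
def stdVol (n : ℕ) : TopForm n :=
  { (EuclideanSpace.basisFun (Fin n) ℝ).toBasis.det with
    cont := by
      change Continuous fun w : Fin n → Euc n =>
        (EuclideanSpace.basisFun (Fin n) ℝ).toBasis.det w
      simp only [Module.Basis.det_apply]
      refine Continuous.matrix_det (continuous_matrix fun i j => ?_)
      simp only [Module.Basis.toMatrix_apply, OrthonormalBasis.coe_toBasis_repr_apply,
        EuclideanSpace.basisFun_repr]
      fun_prop }

/-- The linear map `ξ ↦ (∑_λ v^i_λ ξ^λ)_i` given by an array `v^i_λ`. -/
def arrayCLM {n m : ℕ} (v : Fin m → Fin n → ℝ) : Euc n →L[ℝ] Euc m :=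
  LinearMap.toContinuousLinearMap (Matrix.toEuclideanLin (Matrix.of v))

/-! ### Partial derivatives in coordinates -/

/-- The derivative `∂_i = ∂/∂y^i` of a function of `(x, y, w)`. -/
def dY {n m : ℕ} {W : Type} [NormedAddCommGroup W] [NormedSpace ℝ W] (i : Fin m)
    (f : Euc n × Euc m × W → ℝ) (z : Euc n × Euc m × W) : ℝ :=
  fderiv ℝ f z (0, EuclideanSpace.single i 1, 0)

/-- The derivative `∂^λ_i = ∂/∂y^i_λ` of a function on jet coordinates. -/
def dJet {n m : ℕ} (l : Fin n) (i : Fin m) (f : JetCoord n m → ℝ) (z : JetCoord n m) : ℝ :=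
  fderiv ℝ f z (0, 0, Pi.single i (Pi.single l 1))

/-- The derivative `∂^i_λ = ∂/∂p^λ_i` of a function on momentum coordinates. -/
def dMom {n m : ℕ} (l : Fin n) (i : Fin m) (f : MomCoord n m → ℝ) (z : MomCoord n m) : ℝ :=
  fderiv ℝ f z (0, 0, Pi.single l (Pi.single i 1))

/-- The derivative `∂_λ g` of a vector-valued function of `x ∈ ℝⁿ`. -/
def dX {n : ℕ} {W : Type} [NormedAddCommGroup W] [NormedSpace ℝ W] (l : Fin n)
    (g : Euc n → W) (u : Euc n) : W :=
  fderiv ℝ g u (EuclideanSpace.single l 1)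

/-- The operator `d̂_λ = ∂_λ + ŷ^i_λ ∂_i + y^i_{λμ} ∂^μ_i` applied to a function `f` on jet
coordinates, at the point `z` with further coordinates `yh = (ŷ^i_λ)_i` and
`yy = (y^i_{λμ})_{i,μ}`. On holonomic second order jets it is the total derivative `d_λ`. -/
def dTotal {n m : ℕ} (l : Fin n) (f : JetCoord n m → ℝ) (z : JetCoord n m)
    (yh : Euc m) (yy : Fin m → Fin n → ℝ) : ℝ :=
  fderiv ℝ f z (EuclideanSpace.single l 1, yh, yy)

section Bundle

variable {n m : ℕ}
  {X : Type*} [TopologicalSpace X] [ChartedSpace (Euc n) X]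
  {Y : Type*} [TopologicalSpace Y] [ChartedSpace (Euc n × Euc m) Y]

/-- `π : Y → X` is a smooth (locally trivial) fiber bundle with typical fiber `V`. -/
structure IsSmoothFiberBundle (n m : ℕ)
    {X : Type*} [TopologicalSpace X] [ChartedSpace (Euc n) X]
    {Y : Type*} [TopologicalSpace Y] [ChartedSpace (Euc n × Euc m) Y] (V : Type*) [TopologicalSpace V] [ChartedSpace (Euc m) V]
    (π : Y → X) : Prop where
  contMDiff : ContMDiff 𝓘(ℝ, Euc n × Euc m) 𝓘(ℝ, Euc n) ∞ π
  locally_trivial : ∀ x : X, ∃ e : Bundle.Trivialization V π, x ∈ e.baseSet ∧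
    ContMDiffOn 𝓘(ℝ, Euc n × Euc m) (𝓘(ℝ, Euc n).prod 𝓘(ℝ, Euc m)) ∞ e e.source ∧
    ContMDiffOn (𝓘(ℝ, Euc n).prod 𝓘(ℝ, Euc m)) 𝓘(ℝ, Euc n × Euc m) ∞
      e.toOpenPartialHomeomorph.symm e.target

variable (n m) in
/-- The tangent map `T_y π : T_y Y → T_{π y} X`. -/
def tproj (π : Y → X) (y : Y) : Euc n × Euc m →L[ℝ] Euc n :=
  mfderiv 𝓘(ℝ, Euc n × Euc m) 𝓘(ℝ, Euc n) π y

variable (n m) in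
/-- The fiber over `y` of the affine jet bundle `J¹Y → Y`: the linear maps
`Γ : T_{π y} X → T_y Y` with `T_y π ∘ Γ = id`, that is, the first jets at `π y` of the sections
through `y`. -/
def JetFiber (π : Y → X) (y : Y) : Type :=
  {Γ : Euc n →L[ℝ] Euc n × Euc m // (tproj n m π y).comp Γ = ContinuousLinearMap.id ℝ (Euc n)}

variable (n m) in
/-- The fiber over `y` of `T*X ⊗ VY`: the linear maps `T_{π y} X → T_y Y` with vertical values. It
is the vector space on which the affine space `J¹_y Y` is modelled. -/
def VertHom (π : Y → X) (y : Y) : Submodule ℝ (Euc n →L[ℝ] Euc n × Euc m) where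
  carrier := {σ | (tproj n m π y).comp σ = 0}
  add_mem' := by
    intro a b ha hb
    simp only [Set.mem_ofPred_eq] at *
    rw [ContinuousLinearMap.comp_add, ha, hb, add_zero]
  zero_mem' := by simp
  smul_mem' := by
    intro c a ha
    simp only [Set.mem_ofPred_eq] at *
    rw [ContinuousLinearMap.comp_smul, ha]
    exact smul_zero (A := Euc n →L[ℝ] Euc n) c

variable (n m) in
/-- The fiber over `y` of the Legendre bundle `Π = ⋀ⁿT*X ⊗ V*Y ⊗ TX`, in the form of linear maps
`T*X ⊗ VY → ⋀ⁿT*X`: the element `p^λ_i ω ⊗ dy^i ⊗ ∂_λ` is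
`σ^i_λ dx^λ ⊗ ∂_i ↦ p^λ_i σ^i_λ ω`. -/
abbrev LegendreFiber (π : Y → X) (y : Y) : Type := VertHom n m π y →L[ℝ] TopForm n

instance (π : Y → X) (y : Y) : NormedAddCommGroup (VertHom n m π y) :=
  Submodule.normedAddCommGroup _

instance (π : Y → X) (y : Y) : NormedSpace ℝ (VertHom n m π y) := Submodule.normedSpace _

instance (π : Y → X) (y : Y) : NormedAddCommGroup (LegendreFiber n m π y) :=
  inferInstanceAs (NormedAddCommGroup (VertHom n m π y →L[ℝ] TopForm n))

instance (π : Y → X) (y : Y) : NormedSpace ℝ (LegendreFiber n m π y) :=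
  inferInstanceAs (NormedSpace ℝ (VertHom n m π y →L[ℝ] TopForm n))

variable (n m) in
/-- The jet manifold `J¹Y`. -/
abbrev Jet (π : Y → X) := Σ y : Y, JetFiber n m π y

variable (n m) in
/-- The Legendre bundle `Π`. -/
abbrev Legendre (π : Y → X) := Σ y : Y, LegendreFiber n m π y

/-- The affine structure of `J¹_y Y`: the translate `Γ + σ`. -/
def JetFiber.translate {π : Y → X} {y : Y} (Γ : JetFiber n m π y) (σ : VertHom n m π y) : JetFiber n m π y :=
  ⟨Γ.1 + σ.1, by
    have h : (tproj n m π y).comp σ.1 = 0 := σ.2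
    rw [ContinuousLinearMap.comp_add, Γ.2, h, add_zero]⟩

/-- The affine structure of `J¹_y Y`: the difference `Γ - Γ'`. -/
def JetFiber.diff {π : Y → X} {y : Y} (Γ Γ' : JetFiber n m π y) : VertHom n m π y :=
  ⟨Γ.1 - Γ'.1, by
    change (tproj n m π y).comp (Γ.1 - Γ'.1) = 0
    rw [ContinuousLinearMap.comp_sub, Γ.2, Γ'.2, sub_self]⟩

/-! ### Adapted coordinates -/

variable (n m) in
/-- An adapted coordinate chart `(x^λ, y^i)` of `Y → X`: a chart of the smooth structure of `Y`
whose first `n` coordinates are the pull-backs of the coordinates of a chart of the smooth structure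
of `X`. -/
structure AdaptedChart (π : Y → X) where
  total : OpenPartialHomeomorph Y (Euc n × Euc m)
  base : OpenPartialHomeomorph X (Euc n)
  total_mem : total ∈ IsManifold.maximalAtlas 𝓘(ℝ, Euc n × Euc m) ∞ Y
  base_mem : base ∈ IsManifold.maximalAtlas 𝓘(ℝ, Euc n) ∞ X
  proj_mem : ∀ y ∈ total.source, π y ∈ base.source
  fst_total : ∀ y ∈ total.source, (total y).1 = base (π y)

namespace AdaptedChart

variable {π : Y → X} (c : AdaptedChart n m π)

/-- The differential at `y` of the chart of `Y`. -/
def dtotal (y : Y) : Euc n × Euc m →L[ℝ] Euc n × Euc m :=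
  mfderiv 𝓘(ℝ, Euc n × Euc m) 𝓘(ℝ, Euc n × Euc m) c.total y

/-- The differential at `(x(y), y(y))` of the inverse of the chart of `Y`. -/
def dtotalSymm (y : Y) : Euc n × Euc m →L[ℝ] Euc n × Euc m :=
  mfderiv 𝓘(ℝ, Euc n × Euc m) 𝓘(ℝ, Euc n × Euc m) c.total.symm (c.total y)

/-- The differential at `x` of the chart of `X`. -/
def dbase (x : X) : Euc n →L[ℝ] Euc n :=
  mfderiv 𝓘(ℝ, Euc n) 𝓘(ℝ, Euc n) c.base x

/-- The differential at `x(x)` of the inverse of the chart of `X`. -/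
def dbaseSymm (x : X) : Euc n →L[ℝ] Euc n :=
  mfderiv 𝓘(ℝ, Euc n) 𝓘(ℝ, Euc n) c.base.symm (c.base x)

/-- The coordinate frame `(∂_1, …, ∂_n)` of `T_x X`. -/
def frame (x : X) (l : Fin n) : Euc n := c.dbaseSymm x (EuclideanSpace.single l 1)

/-- The coordinate volume form `ω = dx^1 ∧ ⋯ ∧ dx^n` at `x`. -/
def vol (x : X) : TopForm n := (stdVol n).compContinuousLinearMap (c.dbase x)

end AdaptedChart

end Bundle

section Coordinates

variable {n m : ℕ}
  {X : Type*} [TopologicalSpace X] [ChartedSpace (Euc n) X]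
  {Y : Type*} [TopologicalSpace Y] [ChartedSpace (Euc n × Euc m) Y]
  {π : Y → X}

namespace AdaptedChart

variable (c : AdaptedChart n m π)

theorem dbaseSymm_comp_dbase {x : X} (hx : x ∈ c.base.source) :
    (c.dbaseSymm x).comp (c.dbase x) = ContinuousLinearMap.id ℝ (Euc n) := by
  have h1 : MDifferentiableAt 𝓘(ℝ, Euc n) 𝓘(ℝ, Euc n) c.base x :=
    ((contMDiffOn_of_mem_maximalAtlas c.base_mem).contMDiffAt
      (c.base.open_source.mem_nhds hx)).mdifferentiableAt (by simp)
  have h2 : MDifferentiableAt 𝓘(ℝ, Euc n) 𝓘(ℝ, Euc n) c.base.symm (c.base x) :=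
    ((contMDiffOn_symm_of_mem_maximalAtlas c.base_mem).contMDiffAt
      (c.base.open_target.mem_nhds (c.base.map_source hx))).mdifferentiableAt (by simp)
  have h3 : (c.base.symm ∘ c.base) =ᶠ[nhds x] id := by
    filter_upwards [c.base.open_source.mem_nhds hx] with z hz
    exact c.base.left_inv hz
  have h4 := mfderiv_comp x h2 h1
  rw [h3.mfderiv_eq, mfderiv_id] at h4
  exact h4.symm

/-- In adapted coordinates the projection is `(x, y) ↦ x`. -/
theorem tproj_comp_dtotalSymm {y : Y} (hy : y ∈ c.total.source) :
    (tproj n m π y).comp (c.dtotalSymm y) =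
      (c.dbaseSymm (π y)).comp (ContinuousLinearMap.fst ℝ (Euc n) (Euc m)) := by
  have hu : c.total y ∈ c.total.target := c.total.map_source hy
  have hb : MDifferentiableAt 𝓘(ℝ, Euc n) 𝓘(ℝ, Euc n) c.base.symm (c.base (π y)) :=
    ((contMDiffOn_symm_of_mem_maximalAtlas c.base_mem).contMDiffAt
      (c.base.open_target.mem_nhds
        (c.base.map_source (c.proj_mem y hy)))).mdifferentiableAt (by simp)
  have hbt : MDifferentiableAt 𝓘(ℝ, Euc n) 𝓘(ℝ, Euc n) c.base.symm ((c.total y).1) := by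
    rw [c.fst_total y hy]; exact hb
  have hf : HasMFDerivAt 𝓘(ℝ, Euc n × Euc m) 𝓘(ℝ, Euc n) (Prod.fst : Euc n × Euc m → Euc n)
      (c.total y) (ContinuousLinearMap.fst ℝ (Euc n) (Euc m)) :=
    (hasFDerivAt_fst (𝕜 := ℝ) (p := c.total y)).hasMFDerivAt
  have ht : MDifferentiableAt 𝓘(ℝ, Euc n × Euc m) 𝓘(ℝ, Euc n × Euc m) c.total.symm (c.total y) :=
    ((contMDiffOn_symm_of_mem_maximalAtlas c.total_mem).contMDiffAt
      (c.total.open_target.mem_nhds hu)).mdifferentiableAt (by simp)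
  have htt : MDifferentiableAt 𝓘(ℝ, Euc n × Euc m) 𝓘(ℝ, Euc n × Euc m) c.total y :=
    ((contMDiffOn_of_mem_maximalAtlas c.total_mem).contMDiffAt
      (c.total.open_source.mem_nhds hy)).mdifferentiableAt (by simp)
  -- the projection is differentiable at `y`, since it is `base.symm ∘ fst ∘ total` near `y`
  have hπ₀ : MDifferentiableAt 𝓘(ℝ, Euc n × Euc m) 𝓘(ℝ, Euc n) π y := by
    have h := (hbt.hasMFDerivAt.comp (c.total y) hf).comp y htt.hasMFDerivAt
    refine (h.mdifferentiableAt).congr_of_eventuallyEq ?_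
    filter_upwards [c.total.open_source.mem_nhds hy] with z hz
    simp only [Function.comp_apply]
    rw [c.fst_total z hz, c.base.left_inv (c.proj_mem z hz)]
  have hπ : MDifferentiableAt 𝓘(ℝ, Euc n × Euc m) 𝓘(ℝ, Euc n) π (c.total.symm (c.total y)) := by
    rw [c.total.left_inv hy]; exact hπ₀
  have e1 := mfderiv_comp (c.total y) hπ ht
  have e2 := (hbt.hasMFDerivAt.comp (c.total y) hf).mfderiv
  have e3 : (π ∘ c.total.symm) =ᶠ[nhds (c.total y)]
      (c.base.symm ∘ (Prod.fst : Euc n × Euc m → Euc n)) := by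
    filter_upwards [c.total.open_target.mem_nhds hu] with z hz
    have hs := c.total.map_target hz
    have := c.fst_total _ hs
    rw [c.total.right_inv hz] at this
    simp only [Function.comp_apply]
    rw [this, c.base.left_inv (c.proj_mem _ hs)]
  rw [e3.mfderiv_eq, e2, c.fst_total y hy, c.total.left_inv hy] at e1
  exact e1.symm

/-- The jet at `y` with coordinates `y^i_λ = v^i_λ`, that is,
`dx^λ ⊗ (∂_λ + v^i_λ ∂_i)`. -/
def jet (y : Y) (hy : y ∈ c.total.source) (v : Fin m → Fin n → ℝ) : JetFiber n m π y :=
  ⟨((c.dtotalSymm y).comp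
      ((ContinuousLinearMap.id ℝ (Euc n)).prod (arrayCLM v))).comp (c.dbase (π y)), by
    rw [← ContinuousLinearMap.comp_assoc, ← ContinuousLinearMap.comp_assoc,
      c.tproj_comp_dtotalSymm hy, ContinuousLinearMap.comp_assoc (c.dbaseSymm (π y)),
      ContinuousLinearMap.fst_comp_prod, ContinuousLinearMap.comp_id,
      c.dbaseSymm_comp_dbase (c.proj_mem y hy)]⟩

/-- The element `v^i_λ dx^λ ⊗ ∂_i` of `T*X ⊗ VY` at `y`. -/
def vert (y : Y) (hy : y ∈ c.total.source) (v : Fin m → Fin n → ℝ) : VertHom n m π y :=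
  (c.jet y hy v).diff (c.jet y hy 0)

/-- The fiber coordinates `y^i_λ` of an element of `J¹_y Y`, or the components `σ^i_λ` of an
element of `T*X ⊗ VY`. -/
def components (y : Y) (Γ : Euc n →L[ℝ] Euc n × Euc m) : Fin m → Fin n → ℝ :=
  fun i l => (c.dtotal y (Γ (c.frame (π y) l))).2 i

/-- The adapted coordinates `(x^λ, y^i, y^i_λ)` of `J¹Y`, on the part of `J¹Y` over the domain of
the chart. -/
def jetCoord (z : Jet n m π) : JetCoord n m :=
  ((c.total z.1).1, (c.total z.1).2, c.components z.1 z.2.1)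

/-- The component `σ ↦ σ^i_λ` as a linear function on the fiber of `T*X ⊗ VY`. -/
def componentCLM (y : Y) (l : Fin n) (i : Fin m) : VertHom n m π y →L[ℝ] ℝ :=
  LinearMap.toContinuousLinearMap
    { toFun := fun σ : VertHom n m π y => c.components y σ.1 i l
      map_add' := by intro a b; simp [components]
      map_smul' := by intro a b; simp [components] }

/-- The element `p^λ_i ω ⊗ dy^i ⊗ ∂_λ` of `Π_y`, that is, `σ ↦ p^λ_i σ^i_λ ω`. -/
def momentum (y : Y) (p : Fin n → Fin m → ℝ) : LegendreFiber n m π y :=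
  ∑ l, ∑ i, p l i • (c.componentCLM y l i).smulRight (c.vol (π y))

open Classical in
/-- The adapted coordinates `(x^λ, y^i, p^λ_i)` of the Legendre bundle, on its part over the domain
of the chart: `p^λ_i` is the value of `p(dx^λ ⊗ ∂_i)` on `(∂_1, …, ∂_n)`. -/
def momCoord (q : Legendre n m π) : MomCoord n m :=
  ((c.total q.1).1, (c.total q.1).2, fun l i =>
    if h : q.1 ∈ c.total.source then
      q.2 (c.vert q.1 h (Pi.single i (Pi.single l 1))) (c.frame (π q.1))
    else 0)

/-- The range of the first two coordinates `(x^λ, y^i)`, with no condition on the remaining ones. -/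
def domain (W : Type) : Set (Euc n × Euc m × W) := {z | (z.1, z.2.1) ∈ c.total.target}

open Classical in
/-- The coordinate expression `𝓛(x^λ, y^i, y^i_λ)` of a horizontal density `L = 𝓛 ω` on `J¹Y`. -/
def lagrangian (L : ∀ y, JetFiber n m π y → TopForm n) (z : JetCoord n m) : ℝ :=
  if h : (z.1, z.2.1) ∈ c.total.target then
    L (c.total.symm (z.1, z.2.1)) (c.jet _ (c.total.map_target h) z.2.2)
      (c.frame (π (c.total.symm (z.1, z.2.1))))
  else 0

open Classical in
/-- The coordinate expression `𝓗(x^λ, y^i, p^λ_i)` of a family of affine maps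
`J¹_y Y → ⋀ⁿT*X`, `y^i_λ ↦ (p^λ_i y^i_λ - 𝓗(x, y, p)) ω`: minus the value at `y^i_λ = 0`. -/
def hamiltonian (H : ∀ y, LegendreFiber n m π y → JetFiber n m π y → TopForm n) (z : MomCoord n m) : ℝ :=
  if h : (z.1, z.2.1) ∈ c.total.target then
    - H (c.total.symm (z.1, z.2.1)) (c.momentum _ z.2.2) (c.jet _ (c.total.map_target h) 0)
      (c.frame (π (c.total.symm (z.1, z.2.1))))
  else 0

end AdaptedChart

/-! ### Lagrangians and the Legendre map -/

variable (n m π) in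
/-- A first order Lagrangian: a smooth horizontal density `L = 𝓛 ω : J¹Y → ⋀ⁿT*X`. -/
structure Lagrangian where
  toFun : ∀ y, JetFiber n m π y → TopForm n
  smooth : ∀ c : AdaptedChart n m π, ContDiffOn ℝ ∞ (c.lagrangian toFun) (c.domain _)

/-- The Legendre map `L̂ : J¹Y → Π` over `Y`: the derivative of `L` along the fibers of
`J¹Y → Y`, so that `p^λ_i ∘ L̂ = ∂^λ_i 𝓛`. -/
def Lagrangian.legendre (L : Lagrangian n m π) (y : Y) (Γ : JetFiber n m π y) : LegendreFiber n m π y :=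
  fderiv ℝ (fun σ : VertHom n m π y => L.toFun y (Γ.translate σ)) 0

/-- The Legendre map on total spaces. -/
def Lagrangian.legendreMap (L : Lagrangian n m π) (z : Jet n m π) : Legendre n m π :=
  ⟨z.1, L.legendre z.1 z.2⟩

/-- The Lagrangian constraint space `N_L = L̂(J¹Y)`. -/
def Lagrangian.constraintSpace (L : Lagrangian n m π) : Set (Legendre n m π) :=
  Set.range L.legendreMap

/-- A connected submanifold of `J¹Y`: the image of an injective smooth immersion of a connected
manifold. Smoothness and differentials are taken in the adapted coordinates of `J¹Y`. (Embedded
submanifolds are a special case.) -/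
def IsConnectedSubmanifold (S : Set (Jet n m π)) : Prop :=
  ∃ (k : ℕ) (N : Type) (_ : TopologicalSpace N) (_ : ChartedSpace (Euc k) N)
    (_ : IsManifold 𝓘(ℝ, Euc k) ∞ N) (f : N → Jet n m π),
    T2Space N ∧ SecondCountableTopology N ∧ ConnectedSpace N ∧
    Function.Injective f ∧ Set.range f = S ∧
    ContMDiff 𝓘(ℝ, Euc k) 𝓘(ℝ, Euc n × Euc m) ∞ (fun u => (f u).1) ∧
    ∀ c : AdaptedChart n m π,
      ContMDiffOn 𝓘(ℝ, Euc k) 𝓘(ℝ, JetCoord n m) ∞ (fun u => c.jetCoord (f u))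
        {u | (f u).1 ∈ c.total.source} ∧
      ∀ u, (f u).1 ∈ c.total.source → Function.Injective
        (mfderiv 𝓘(ℝ, Euc k) 𝓘(ℝ, JetCoord n m) (fun u => c.jetCoord (f u)) u)

/-- `L` is semiregular: the pre-image `L̂⁻¹(q)` of any point `q ∈ N_L` is a connected submanifold
of `J¹Y`. -/
def Lagrangian.IsSemiregular (L : Lagrangian n m π) : Prop :=
  ∀ q ∈ L.constraintSpace, IsConnectedSubmanifold (L.legendreMap ⁻¹' {q})

/-! ### Hamiltonian forms -/

variable (n m π) in
/-- A Hamiltonian form `H = h^* Ξ_Y = p^λ_i dy^i ∧ ω_λ - 𝓗 ω` on `Π`, given by the smooth section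
`h` of `Z_Y → Π`. The homogeneous Legendre bundle `Z_Y = J^{1⋆}Y` consists of the affine maps
`J¹_y Y → ⋀ⁿT*X`, and `Z_Y → Π` takes an affine map to its linear part: the point
`p^λ_i dy^i ∧ ω_λ - 𝓗 ω` of `Z_Y` is the map `Γ ↦ Γ^*(p^λ_i dy^i ∧ ω_λ - 𝓗 ω)`, in coordinates
`y^i_λ ↦ (p^λ_i y^i_λ - 𝓗) ω`. Thus `toFun y p` is an affine map on `J¹_y Y` with linear part
`p`. -/
structure HamiltonianForm where
  toFun : ∀ y, LegendreFiber n m π y → JetFiber n m π y → TopForm n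
  linear_part : ∀ (y : Y) (p : LegendreFiber n m π y) (Γ Γ' : JetFiber n m π y),
    toFun y p Γ = toFun y p Γ' + p (Γ.diff Γ')
  smooth : ∀ c : AdaptedChart n m π, ContDiffOn ℝ ∞ (c.hamiltonian toFun) (c.domain _)

variable {V : Type*} [TopologicalSpace V] [ChartedSpace (Euc m) V]

theorem IsSmoothFiberBundle.nonempty_jetFiber (hπ : IsSmoothFiberBundle n m V π) (y : Y) :
    Nonempty (JetFiber n m π y) := by
  obtain ⟨e, hx, -, he⟩ := hπ.locally_trivial (π y)
  have hy : y ∈ e.source := e.mem_source.2 hx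
  let s : X → Y := fun x => e.toOpenPartialHomeomorph.symm (x, (e y).2)
  have hs : s (π y) = y := by
    have h : (π y, (e y).2) = e y := Prod.ext (e.coe_fst hy).symm rfl
    change e.toOpenPartialHomeomorph.symm (π y, (e y).2) = y
    rw [h]
    exact e.toOpenPartialHomeomorph.left_inv hy
  have ht : ∀ x ∈ e.baseSet, (x, (e y).2) ∈ e.target := fun x h => e.mem_target.2 h
  have hsd : MDifferentiableAt 𝓘(ℝ, Euc n) 𝓘(ℝ, Euc n × Euc m) s (π y) := by
    have h1 : ContMDiffAt (𝓘(ℝ, Euc n).prod 𝓘(ℝ, Euc m)) 𝓘(ℝ, Euc n × Euc m) ∞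
        e.toOpenPartialHomeomorph.symm (π y, (e y).2) :=
      he.contMDiffAt (e.open_target.mem_nhds (ht _ hx))
    have h2 : ContMDiffAt 𝓘(ℝ, Euc n) (𝓘(ℝ, Euc n).prod 𝓘(ℝ, Euc m)) ∞
        (fun x : X => (x, (e y).2)) (π y) := contMDiffAt_id.prodMk contMDiffAt_const
    exact (h1.comp (π y) h2).mdifferentiableAt (by simp)
  have hπd : MDifferentiableAt 𝓘(ℝ, Euc n × Euc m) 𝓘(ℝ, Euc n) π (s (π y)) :=
    hπ.contMDiff.contMDiffAt.mdifferentiableAt (by simp)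
  have h3 : (π ∘ s) =ᶠ[nhds (π y)] id := by
    filter_upwards [e.open_baseSet.mem_nhds hx] with x h
    exact e.proj_symm_apply (ht x h)
  have h4 := mfderiv_comp (π y) hπd hsd
  rw [h3.mfderiv_eq, mfderiv_id, hs] at h4
  exact ⟨⟨mfderiv 𝓘(ℝ, Euc n) 𝓘(ℝ, Euc n × Euc m) s (π y), h4.symm⟩⟩

/-- Biduality: a linear map `Hom(W, ⋀ⁿ) → ⋀ⁿ` is the evaluation at a vector of `W`. -/
theorem exists_eval_eq {W : Type*} [NormedAddCommGroup W] [NormedSpace ℝ W]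
    [FiniteDimensional ℝ W] (T : (W →L[ℝ] TopForm n) →L[ℝ] TopForm n) :
    ∃ w : W, ∀ δ : W →L[ℝ] TopForm n, T δ = δ w := by
  have hb : ∀ α : TopForm n,
      α = α (EuclideanSpace.basisFun (Fin n) ℝ).toBasis • stdVol n := by
    intro α
    apply ContinuousAlternatingMap.toAlternatingMap_injective
    exact AlternatingMap.eq_smul_basis_det (EuclideanSpace.basisFun (Fin n) ℝ).toBasis
      α.toAlternatingMap
  let φ : Dual ℝ (Dual ℝ W) :=
    { toFun := fun ℓ => T ((LinearMap.toContinuousLinearMap ℓ).smulRight (stdVol n))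
        (EuclideanSpace.basisFun (Fin n) ℝ).toBasis
      map_add' := by
        intro a b
        have : (LinearMap.toContinuousLinearMap (a + b)).smulRight (stdVol n) =
          (LinearMap.toContinuousLinearMap a).smulRight (stdVol n) +
          (LinearMap.toContinuousLinearMap b).smulRight (stdVol n) := by
            ext w v; simp [add_mul]
        rw [this, map_add]; rfl
      map_smul' := by
        intro a b
        have : (LinearMap.toContinuousLinearMap (a • b)).smulRight (stdVol n) =
          a • (LinearMap.toContinuousLinearMap b).smulRight (stdVol n) := by
            ext w v; simp [mul_assoc]
        rw [this, map_smul]; rfl }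
  refine ⟨(Module.evalEquiv ℝ W).symm φ, fun δ => ?_⟩
  let ℓ : Dual ℝ W :=
    { toFun := fun w => δ w (EuclideanSpace.basisFun (Fin n) ℝ).toBasis
      map_add' := by intro a b; simp
      map_smul' := by intro a b; simp }
  have hδ : δ = (LinearMap.toContinuousLinearMap ℓ).smulRight (stdVol n) := by
    refine ContinuousLinearMap.ext fun w => ?_
    exact hb (δ w)
  have h1 : φ ℓ = ℓ ((Module.evalEquiv ℝ W).symm φ) := by
    conv_lhs => rw [← (Module.evalEquiv ℝ W).apply_symm_apply φ]
    rfl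
  rw [hb (T δ), hb (δ ((Module.evalEquiv ℝ W).symm φ))]
  congr 1
  have h2 : φ ℓ = T δ (EuclideanSpace.basisFun (Fin n) ℝ).toBasis := by
    rw [hδ]
    rfl
  rw [← h2, h1]
  rfl

/-- For a given jet `Γ₀`, there is a jet `Φ` at `y` with
`∂(H(p)(Γ₀))/∂p · δ = δ(Γ₀ - Φ)` for all `δ ∈ Π_y`. As
`H(p)(Γ₀) = (p^λ_i (Γ₀)^i_λ - 𝓗) ω`, this means that `Φ^i_λ = ∂^i_λ 𝓗`; in particular, `Φ` does
not depend on `Γ₀`. -/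
theorem HamiltonianForm.exists_map (H : HamiltonianForm n m π) (y : Y) (p : LegendreFiber n m π y)
    (Γ₀ : JetFiber n m π y) :
    ∃ Φ : JetFiber n m π y, ∀ δ : LegendreFiber n m π y,
      fderiv ℝ (fun p' : LegendreFiber n m π y => H.toFun y p' Γ₀) p δ = δ (Γ₀.diff Φ) := by
  obtain ⟨w, hw⟩ := exists_eval_eq (fderiv ℝ (fun p' : LegendreFiber n m π y => H.toFun y p' Γ₀) p)
  refine ⟨Γ₀.translate (-w), fun δ => ?_⟩
  rw [hw]
  congr 1
  apply Subtype.ext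
  simp [JetFiber.diff, JetFiber.translate]

/-- The Hamiltonian map `Ĥ : Π → J¹Y` over `Y`, with `y^i_λ ∘ Ĥ = ∂^i_λ 𝓗`. -/
def HamiltonianForm.map (hπ : IsSmoothFiberBundle n m V π) (H : HamiltonianForm n m π) (y : Y)
    (p : LegendreFiber n m π y) : JetFiber n m π y :=
  (H.exists_map y p (hπ.nonempty_jetFiber y).some).choose

/-- The Hamiltonian form `H_Φ = Φ ⌋ θ = p^λ_i dy^i ∧ ω_λ - p^λ_i Φ^i_λ ω` of a bundle morphism
`Φ : Π → J¹Y` over `Y`, as the family of affine maps `Γ ↦ p(Γ - Φ(p))`. -/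
def formOfMap (Φ : ∀ y, LegendreFiber n m π y → JetFiber n m π y) (y : Y) (p : LegendreFiber n m π y)
    (Γ : JetFiber n m π y) : TopForm n :=
  p (Γ.diff (Φ y p))

/-- `H` is associated with `L`: `L̂ ∘ Ĥ ∘ L̂ = L̂` and `H = H_Ĥ + Ĥ^* L`. -/
structure HamiltonianForm.IsAssociated (hπ : IsSmoothFiberBundle n m V π) (H : HamiltonianForm n m π)
    (L : Lagrangian n m π) : Prop where
  legendre_map_legendre : ∀ (y : Y) (Γ : JetFiber n m π y),
    L.legendre y (H.map hπ y (L.legendre y Γ)) = L.legendre y Γ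
  form_eq : ∀ (y : Y) (p : LegendreFiber n m π y) (Γ : JetFiber n m π y),
    H.toFun y p Γ = formOfMap (H.map hπ) y p Γ + L.toFun y (H.map hπ y p)

/-! ### Sections and equations -/

/-- A smooth section of `Y → X`. -/
def IsSection (n m : ℕ)
    {X : Type*} [TopologicalSpace X] [ChartedSpace (Euc n) X]
    {Y : Type*} [TopologicalSpace Y] [ChartedSpace (Euc n × Euc m) Y] (π : Y → X) (s : X → Y) : Prop :=
  ContMDiff 𝓘(ℝ, Euc n) 𝓘(ℝ, Euc n × Euc m) ∞ s ∧ ∀ x, π (s x) = x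

/-- A smooth section of `J¹Y → X`. -/
def IsJetSection (s : X → Jet n m π) : Prop :=
  IsSection n m π (fun x => (s x).1) ∧ ∀ c : AdaptedChart n m π,
    ContMDiffOn 𝓘(ℝ, Euc n) 𝓘(ℝ, JetCoord n m) ∞ (fun x => c.jetCoord (s x))
      {x | (s x).1 ∈ c.total.source}

/-- A smooth section of `Π → X`. -/
def IsLegendreSection (r : X → Legendre n m π) : Prop :=
  IsSection n m π (fun x => (r x).1) ∧ ∀ c : AdaptedChart n m π,
    ContMDiffOn 𝓘(ℝ, Euc n) 𝓘(ℝ, MomCoord n m) ∞ (fun x => c.momCoord (r x))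
      {x | (r x).1 ∈ c.total.source}

/-- `r` is a solution of the Hamilton equations `y^i_λ = ∂^i_λ 𝓗`, `p^λ_{λ i} = -∂_i 𝓗`: they hold
for the first jet of `r` at every point and in all adapted coordinates. -/
def HamiltonianForm.IsHamiltonSolution (H : HamiltonianForm n m π) (r : X → Legendre n m π) : Prop :=
  IsLegendreSection r ∧
  ∀ (c : AdaptedChart n m π) (x : X), (r x).1 ∈ c.total.source →
    let ζ : Euc n → MomCoord n m := fun u => c.momCoord (r (c.base.symm u))
    let u₀ : Euc n := c.base x
    (∀ l i, dX l (fun u => (ζ u).2.1) u₀ i = dMom l i (c.hamiltonian H.toFun) (ζ u₀)) ∧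
    ∀ i, ∑ l, dX l (fun u => (ζ u).2.2) u₀ l i = - dY i (c.hamiltonian H.toFun) (ζ u₀)

/-- `s` is a solution of the Euler–Lagrange equations `(∂_i - d_λ ∂^λ_i) 𝓛 = 0`: they hold for the
second jet of `s` at every point and in all adapted coordinates. -/
def Lagrangian.IsEulerLagrangeSolution (L : Lagrangian n m π) (s : X → Y) : Prop :=
  IsSection n m π s ∧
  ∀ (c : AdaptedChart n m π) (x : X), s x ∈ c.total.source →
    let y : Euc n → Euc m := fun u => (c.total (s (c.base.symm u))).2
    let y' : Euc n → Fin m → Fin n → ℝ := fun u i l => dX l y u i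
    let u₀ : Euc n := c.base x
    let z : JetCoord n m := (u₀, y u₀, y' u₀)
    ∀ i, dY i (c.lagrangian L.toFun) z -
      ∑ l, dTotal l (dJet l i (c.lagrangian L.toFun)) z (dX l y u₀) (dX l y' u₀) = 0

/-- `s` is a solution of the Cartan equations
`∂^λ_i π^μ_j (ŷ^j_μ - y^j_μ) = 0`,
`∂_i 𝓛 - d̂_λ π^λ_i + (ŷ^j_λ - y^j_λ) ∂_i π^λ_j = 0`, where `π^λ_i = ∂^λ_i 𝓛`: they hold for the
first jet `(x^λ, y^i, y^i_λ, ŷ^i_λ, y^i_{λμ})` of `s` at every point and in all adapted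
coordinates. -/
def Lagrangian.IsCartanSolution (L : Lagrangian n m π) (s : X → Jet n m π) : Prop :=
  IsJetSection s ∧
  ∀ (c : AdaptedChart n m π) (x : X), (s x).1 ∈ c.total.source →
    let ζ : Euc n → JetCoord n m := fun u => c.jetCoord (s (c.base.symm u))
    let u₀ : Euc n := c.base x
    let z : JetCoord n m := ζ u₀
    let yh : Fin n → Euc m := fun l => dX l (fun u => (ζ u).2.1) u₀
    let yy : Fin n → Fin m → Fin n → ℝ := fun l => dX l (fun u => (ζ u).2.2) u₀
    let P : Fin n → Fin m → JetCoord n m → ℝ := fun l i => dJet l i (c.lagrangian L.toFun)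
    (∀ l i, ∑ k, ∑ j, dJet l i (P k j) z * (yh k j - z.2.2 j k) = 0) ∧
    ∀ i, dY i (c.lagrangian L.toFun) z - ∑ l, dTotal l (P l i) z (yh l) (yy l) +
      ∑ l, ∑ j, (yh l j - z.2.2 j l) * dY i (P l j) z = 0

end Coordinates

end CovariantHamilton

end

/-!
The Hamilton equations `∂_λ r^i = ∂^i_λ 𝓗` say that, in adapted coordinates, `Ĥ ∘ r` is the first
jet prolongation of `s = π_{ΠY} ∘ r` (`jetCoord_map_section`). Hence `ŷ^i_λ = y^i_λ` along
`Ĥ ∘ r`: the first Cartan equation holds trivially, and the second one and the Euler–Lagrange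
equation are both the identity `∂_i 𝓛 = d̂_λ π^λ_i` along `Ĥ ∘ r`
(`dY_lagrangian_eq_sum_dTotal`).

Two facts give this identity. Since `r` takes values in the constraint space and
`L̂ ∘ Ĥ ∘ L̂ = L̂`, one has `L̂ ∘ Ĥ ∘ r = r`, so that `π^λ_i ∘ Ĥ ∘ r = r^λ_i`
(`dJet_jetCoord_map`), and by the chain rule the right-hand side is `∂_λ r^λ_i`, which is `-∂_i 𝓗`
by the remaining Hamilton equations. On the other hand, `H = H_Ĥ + Ĥ^* L` reads
`𝓗 = p^λ_i φ^i_λ - 𝓛(x, y, φ)` with `φ^i_λ = ∂^i_λ 𝓗`. Where `p^λ_i = π^λ_i(x, y, φ)`, the terms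
containing `∂_i φ` cancel when this is differentiated with respect to `y^i`, and there remains
`∂_i 𝓗 = -∂_i 𝓛` (`dY_lagrangian_eq_neg_dY_hamiltonian`).

The jets, the momenta and the maps `L̂` and `Ĥ` are defined without coordinates, as linear maps
between tangent spaces and as derivatives on the fibers. Most of the lemmas translate them into
adapted coordinates.
-/

namespace CovariantHamilton

section Coordinates

variable {n m : ℕ}
  {X : Type*} [TopologicalSpace X] [ChartedSpace (Euc n) X]
  {Y : Type*} [TopologicalSpace Y] [ChartedSpace (Euc n × Euc m) Y]
  {V : Type*} [TopologicalSpace V] [ChartedSpace (Euc m) V]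
  {π : Y → X}

namespace AdaptedChart

variable (c : AdaptedChart n m π)

/-! ### Differentials of adapted charts -/

theorem dbase_comp_dbaseSymm {x : X} (hx : x ∈ c.base.source) :
    (c.dbase x).comp (c.dbaseSymm x) = ContinuousLinearMap.id ℝ (Euc n) := by
  have h : Function.LeftInverse (c.dbaseSymm x) (c.dbase x) := fun v =>
    DFunLike.congr_fun (c.dbaseSymm_comp_dbase hx) v
  have hs : Function.Surjective (c.dbase x) :=
    LinearMap.injective_iff_surjective (f := (c.dbase x).toLinearMap) |>.1 h.injective
  exact ContinuousLinearMap.ext (h.rightInverse_of_surjective hs)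

theorem dtotalSymm_comp_dtotal {y : Y} (hy : y ∈ c.total.source) :
    (c.dtotalSymm y).comp (c.dtotal y) = ContinuousLinearMap.id ℝ (Euc n × Euc m) := by
  have h1 : MDifferentiableAt 𝓘(ℝ, Euc n × Euc m) 𝓘(ℝ, Euc n × Euc m) c.total y :=
    ((contMDiffOn_of_mem_maximalAtlas c.total_mem).contMDiffAt
      (c.total.open_source.mem_nhds hy)).mdifferentiableAt (by simp)
  have h2 : MDifferentiableAt 𝓘(ℝ, Euc n × Euc m) 𝓘(ℝ, Euc n × Euc m) c.total.symm (c.total y) :=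
    ((contMDiffOn_symm_of_mem_maximalAtlas c.total_mem).contMDiffAt
      (c.total.open_target.mem_nhds (c.total.map_source hy))).mdifferentiableAt (by simp)
  have h3 : (c.total.symm ∘ c.total) =ᶠ[nhds y] id := by
    filter_upwards [c.total.open_source.mem_nhds hy] with z hz
    exact c.total.left_inv hz
  have h4 := mfderiv_comp y h2 h1
  rw [h3.mfderiv_eq, mfderiv_id] at h4
  exact h4.symm

theorem dtotal_comp_dtotalSymm {y : Y} (hy : y ∈ c.total.source) :
    (c.dtotal y).comp (c.dtotalSymm y) = ContinuousLinearMap.id ℝ (Euc n × Euc m) := by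
  have h : Function.LeftInverse (c.dtotalSymm y) (c.dtotal y) := fun v =>
    DFunLike.congr_fun (c.dtotalSymm_comp_dtotal hy) v
  have hs : Function.Surjective (c.dtotal y) :=
    LinearMap.injective_iff_surjective (f := (c.dtotal y).toLinearMap) |>.1 h.injective
  exact ContinuousLinearMap.ext (h.rightInverse_of_surjective hs)

theorem dbaseSymm_dbase {x : X} (hx : x ∈ c.base.source) (v : Euc n) :
    c.dbaseSymm x (c.dbase x v) = v :=
  DFunLike.congr_fun (c.dbaseSymm_comp_dbase hx) v

theorem dbase_dbaseSymm {x : X} (hx : x ∈ c.base.source) (v : Euc n) :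
    c.dbase x (c.dbaseSymm x v) = v :=
  DFunLike.congr_fun (c.dbase_comp_dbaseSymm hx) v

theorem dtotalSymm_dtotal {y : Y} (hy : y ∈ c.total.source) (v : Euc n × Euc m) :
    c.dtotalSymm y (c.dtotal y v) = v :=
  DFunLike.congr_fun (c.dtotalSymm_comp_dtotal hy) v

theorem dtotal_dtotalSymm {y : Y} (hy : y ∈ c.total.source) (v : Euc n × Euc m) :
    c.dtotal y (c.dtotalSymm y v) = v :=
  DFunLike.congr_fun (c.dtotal_comp_dtotalSymm hy) v

theorem fst_dtotal {y : Y} (hy : y ∈ c.total.source) (v : Euc n × Euc m) :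
    (c.dtotal y v).1 = c.dbase (π y) (tproj n m π y v) := by
  have h : tproj n m π y (c.dtotalSymm y (c.dtotal y v)) =
      c.dbaseSymm (π y) (c.dtotal y v).1 :=
    DFunLike.congr_fun (c.tproj_comp_dtotalSymm hy) (c.dtotal y v)
  rw [c.dtotalSymm_dtotal hy] at h
  rw [h, c.dbase_dbaseSymm (c.proj_mem y hy)]

/-! ### Fiber coordinates of jets and momenta -/

theorem arrayCLM_single (v : Fin m → Fin n → ℝ) (l : Fin n) (i : Fin m) :
    arrayCLM v (EuclideanSpace.single l 1) i = v i l := by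
  simp [arrayCLM, Matrix.toEuclideanLin, Matrix.toLpLin_apply]

theorem components_jet {y : Y} (hy : y ∈ c.total.source) (v : Fin m → Fin n → ℝ) :
    c.components y (c.jet y hy v).1 = v := by
  funext i l
  change (c.dtotal y (c.dtotalSymm y (_, arrayCLM v (c.dbase (π y) (c.dbaseSymm (π y) _))))).2 i = _
  rw [c.dtotal_dtotalSymm hy, c.dbase_dbaseSymm (c.proj_mem y hy), arrayCLM_single]

theorem components_add (y : Y) (A B : Euc n →L[ℝ] Euc n × Euc m) :
    c.components y (A + B) = c.components y A + c.components y B := by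
  funext i l; simp [components]

theorem components_sub (y : Y) (A B : Euc n →L[ℝ] Euc n × Euc m) :
    c.components y (A - B) = c.components y A - c.components y B := by
  funext i l; simp [components]

/-- A linear map `T_x X → T_y Y` is determined by its components and its projection to `T_x X`. -/
theorem ext_components {y : Y} (hy : y ∈ c.total.source) {A B : Euc n →L[ℝ] Euc n × Euc m}
    (hp : (tproj n m π y).comp A = (tproj n m π y).comp B)
    (h : c.components y A = c.components y B) : A = B := by
  have key : ((c.dtotal y).comp A).comp (c.dbaseSymm (π y)) =
      ((c.dtotal y).comp B).comp (c.dbaseSymm (π y)) := by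
    apply ContinuousLinearMap.coe_injective
    refine (EuclideanSpace.basisFun (Fin n) ℝ).toBasis.ext fun l => ?_
    simp only [OrthonormalBasis.coe_toBasis, EuclideanSpace.basisFun_apply]
    refine Prod.ext ?_ ?_
    · change (c.dtotal y (A _)).1 = (c.dtotal y (B _)).1
      rw [c.fst_dtotal hy, c.fst_dtotal hy]
      exact congrArg _ (DFunLike.congr_fun hp _)
    · ext i
      exact congrFun (congrFun h i) l
  refine ContinuousLinearMap.ext fun v => ?_
  have := DFunLike.congr_fun key (c.dbase (π y) v)
  change c.dtotal y (A (c.dbaseSymm (π y) (c.dbase (π y) v))) =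
    c.dtotal y (B (c.dbaseSymm (π y) (c.dbase (π y) v))) at this
  rw [c.dbaseSymm_dbase (c.proj_mem y hy)] at this
  rw [← c.dtotalSymm_dtotal hy (A v), this, c.dtotalSymm_dtotal hy]

theorem jet_components {y : Y} (hy : y ∈ c.total.source) (Γ : JetFiber n m π y) :
    c.jet y hy (c.components y Γ.1) = Γ := by
  apply Subtype.ext
  refine c.ext_components hy ?_ (c.components_jet hy _)
  rw [Γ.2, (c.jet y hy _).2]

theorem components_vert {y : Y} (hy : y ∈ c.total.source) (v : Fin m → Fin n → ℝ) :
    c.components y (c.vert y hy v).1 = v := by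
  change c.components y ((c.jet y hy v).1 - (c.jet y hy 0).1) = v
  rw [components_sub, components_jet, components_jet, sub_zero]

theorem vert_components {y : Y} (hy : y ∈ c.total.source) (σ : VertHom n m π y) :
    c.vert y hy (c.components y σ.1) = σ := by
  apply Subtype.ext
  refine c.ext_components hy ?_ (c.components_vert hy _)
  rw [(c.vert y hy _).2, σ.2]

/-- The components `σ^i_λ` as a linear map on the fiber of `T*X ⊗ VY`. -/
noncomputable def componentsCLM (y : Y) : VertHom n m π y →L[ℝ] (Fin m → Fin n → ℝ) :=
  ContinuousLinearMap.pi fun i => ContinuousLinearMap.pi fun l => c.componentCLM y l i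

theorem componentsCLM_apply (y : Y) (σ : VertHom n m π y) :
    c.componentsCLM y σ = c.components y σ.1 := rfl

theorem componentCLM_apply (y : Y) (l : Fin n) (i : Fin m) (σ : VertHom n m π y) :
    c.componentCLM y l i σ = c.components y σ.1 i l := rfl

theorem vol_frame {x : X} (hx : x ∈ c.base.source) : c.vol x (c.frame x) = 1 := by
  change (EuclideanSpace.basisFun (Fin n) ℝ).toBasis.det
    (fun l => c.dbase x (c.dbaseSymm x (EuclideanSpace.single l 1))) = 1
  simp only [c.dbase_dbaseSymm hx]
  convert (EuclideanSpace.basisFun (Fin n) ℝ).toBasis.det_self using 2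
  funext l
  simp

/-- `⋀ⁿ T*_x X` is spanned by `ω`, and the coefficient is the value on the coordinate frame. -/
theorem eq_smul_vol {x : X} (hx : x ∈ c.base.source) (α : TopForm n) :
    α = α (c.frame x) • c.vol x := by
  have hb : ∀ β : TopForm n,
      β = β (EuclideanSpace.basisFun (Fin n) ℝ).toBasis • stdVol n := by
    intro β
    apply ContinuousAlternatingMap.toAlternatingMap_injective
    exact AlternatingMap.eq_smul_basis_det (EuclideanSpace.basisFun (Fin n) ℝ).toBasis
      β.toAlternatingMap
  have h := hb (α.compContinuousLinearMap (c.dbaseSymm x))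
  ext v
  have h2 := DFunLike.congr_fun h (fun l => c.dbase x (v l))
  have h3 : (fun l => c.dbaseSymm x (EuclideanSpace.single l 1)) = c.frame x := rfl
  simp only [ContinuousAlternatingMap.compContinuousLinearMap_apply, Function.comp_def,
    c.dbaseSymm_dbase hx, ContinuousAlternatingMap.smul_apply, OrthonormalBasis.coe_toBasis,
    EuclideanSpace.basisFun_apply, h3] at h2
  exact h2

theorem topForm_ext {x : X} (hx : x ∈ c.base.source) {α β : TopForm n}
    (h : α (c.frame x) = β (c.frame x)) : α = β := by
  rw [c.eq_smul_vol hx α, c.eq_smul_vol hx β, h]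

theorem momentum_apply_frame {y : Y} (hy : y ∈ c.total.source) (p : Fin n → Fin m → ℝ)
    (σ : VertHom n m π y) :
    c.momentum y p σ (c.frame (π y)) = ∑ l, ∑ i, p l i * c.components y σ.1 i l := by
  simp [momentum, c.vol_frame (c.proj_mem y hy), componentCLM_apply,
    ContinuousAlternatingMap.sum_apply]

/-- The coordinates `p^λ_i` on the fiber `Π_y`, as a linear map. -/
noncomputable def momentumCoordCLM {y : Y} (hy : y ∈ c.total.source) :
    LegendreFiber n m π y →L[ℝ] (Fin n → Fin m → ℝ) :=
  ContinuousLinearMap.pi fun l => ContinuousLinearMap.pi fun i =>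
    (ContinuousAlternatingMap.apply ℝ (Euc n) ℝ (c.frame (π y))).comp
      (ContinuousLinearMap.apply ℝ (TopForm n) (c.vert y hy (Pi.single i (Pi.single l 1))))

theorem momentumCoordCLM_apply {y : Y} (hy : y ∈ c.total.source) (p : LegendreFiber n m π y)
    (l : Fin n) (i : Fin m) :
    c.momentumCoordCLM hy p l i =
      p (c.vert y hy (Pi.single i (Pi.single l 1))) (c.frame (π y)) := rfl

theorem momCoord_mk {y : Y} (hy : y ∈ c.total.source) (p : LegendreFiber n m π y) :
    c.momCoord ⟨y, p⟩ = ((c.total y).1, (c.total y).2, c.momentumCoordCLM hy p) := by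
  simp only [momCoord, hy, dif_pos]
  rfl

theorem momentumCoordCLM_momentum {y : Y} (hy : y ∈ c.total.source) (p : Fin n → Fin m → ℝ) :
    c.momentumCoordCLM hy (c.momentum y p) = p := by
  funext l i
  rw [momentumCoordCLM_apply, c.momentum_apply_frame hy, components_vert]
  simp [Pi.single_apply, apply_ite, ite_apply]

/-- The elements `dx^λ ⊗ ∂_i` span the fiber of `T*X ⊗ VY`. -/
theorem sum_smul_vert_single {y : Y} (hy : y ∈ c.total.source) (σ : VertHom n m π y) :
    ∑ l, ∑ i, c.components y σ.1 i l • c.vert y hy (Pi.single i (Pi.single l 1)) = σ := by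
  have hinj : Function.Injective (c.componentsCLM (π := π) y) := fun a b hab => by
    rw [← c.vert_components hy a, ← c.vert_components hy b]
    exact congrArg _ hab
  apply hinj
  simp only [map_sum, map_smul, componentsCLM_apply, components_vert]
  funext i l
  simp [Finset.sum_apply, Pi.single_apply]

theorem momentum_momentumCoordCLM {y : Y} (hy : y ∈ c.total.source) (p : LegendreFiber n m π y) :
    c.momentum y (c.momentumCoordCLM hy p) = p := by
  refine ContinuousLinearMap.ext fun σ => c.topForm_ext (c.proj_mem y hy) ?_
  rw [c.momentum_apply_frame hy]
  conv_rhs => rw [← c.sum_smul_vert_single hy σ]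
  simp [ContinuousAlternatingMap.sum_apply, momentumCoordCLM_apply, mul_comm]

theorem jetCoord_mem_domain {y : Y} (hy : y ∈ c.total.source) (Γ : JetFiber n m π y) :
    c.jetCoord ⟨y, Γ⟩ ∈ c.domain (Fin m → Fin n → ℝ) :=
  c.total.map_source hy

theorem momCoord_mem_domain {y : Y} (hy : y ∈ c.total.source) (p : LegendreFiber n m π y) :
    c.momCoord ⟨y, p⟩ ∈ c.domain (Fin n → Fin m → ℝ) :=
  c.total.map_source hy

theorem isOpen_domain (W : Type) [TopologicalSpace W] : IsOpen (c.domain W) := by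
  have : Continuous fun z : Euc n × Euc m × W => (z.1, z.2.1) := by fun_prop
  exact c.total.open_target.preimage this

theorem lagrangian_apply (L : ∀ y, JetFiber n m π y → TopForm n) {y : Y}
    (hy : y ∈ c.total.source) (v : Fin m → Fin n → ℝ) :
    c.lagrangian L ((c.total y).1, (c.total y).2, v) = L y (c.jet y hy v) (c.frame (π y)) := by
  have key : ∀ (y' : Y) (h' : y' ∈ c.total.source), y' = y →
      L y' (c.jet y' h' v) (c.frame (π y')) = L y (c.jet y hy v) (c.frame (π y)) := by
    rintro _ _ rfl; rfl
  unfold lagrangian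
  rw [dif_pos (c.total.map_source hy)]
  exact key _ _ (c.total.left_inv hy)

theorem lagrangian_jetCoord (L : ∀ y, JetFiber n m π y → TopForm n) {y : Y}
    (hy : y ∈ c.total.source) (Γ : JetFiber n m π y) :
    c.lagrangian L (c.jetCoord ⟨y, Γ⟩) = L y Γ (c.frame (π y)) := by
  conv_rhs => rw [← c.jet_components hy Γ]
  exact c.lagrangian_apply L hy _

theorem hamiltonian_momCoord (H : ∀ y, LegendreFiber n m π y → JetFiber n m π y → TopForm n)
    {y : Y} (hy : y ∈ c.total.source) (p : LegendreFiber n m π y) :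
    c.hamiltonian H (c.momCoord ⟨y, p⟩) = - H y p (c.jet y hy 0) (c.frame (π y)) := by
  have key : ∀ (y' : Y) (h' : y' ∈ c.total.source) (q : Fin n → Fin m → ℝ), y' = y →
      - H y' (c.momentum y' q) (c.jet y' h' 0) (c.frame (π y')) =
        - H y (c.momentum y q) (c.jet y hy 0) (c.frame (π y)) := by
    rintro _ _ _ rfl; rfl
  conv_rhs => rw [← c.momentum_momentumCoordCLM hy p]
  rw [c.momCoord_mk hy]
  unfold hamiltonian
  rw [dif_pos (c.total.map_source hy)]
  exact key _ _ _ (c.total.left_inv hy)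

/-! ### The Legendre and Hamiltonian maps in coordinates -/

/-- The coordinate expression `p^λ_i ∘ L̂ = ∂^λ_i 𝓛` of the Legendre map. -/
theorem momentumCoordCLM_legendre (L : Lagrangian n m π) {y : Y} (hy : y ∈ c.total.source)
    (Γ : JetFiber n m π y) (l : Fin n) (i : Fin m) :
    c.momentumCoordCLM hy (L.legendre y Γ) l i =
      dJet l i (c.lagrangian L.toFun) (c.jetCoord ⟨y, Γ⟩) := by
  have hx := c.proj_mem y hy
  -- Written as a multiple of `ω`, the density `L` on the fiber is a function of the coordinates.
  have hF : (fun σ : VertHom n m π y => L.toFun y (Γ.translate σ)) = fun σ =>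
      c.lagrangian L.toFun ((c.total y).1, (c.total y).2,
        c.components y Γ.1 + c.componentsCLM y σ) • c.vol (π y) := by
    funext σ
    rw [c.eq_smul_vol hx (L.toFun y (Γ.translate σ)), ← c.lagrangian_jetCoord L.toFun hy]
    simp only [jetCoord, JetFiber.translate, components_add, componentsCLM_apply]
  have hl : HasFDerivAt (c.lagrangian L.toFun) (fderiv ℝ (c.lagrangian L.toFun) (c.jetCoord ⟨y, Γ⟩))
      ((c.total y).1, (c.total y).2, c.components y Γ.1 + c.componentsCLM (π := π) y 0) := by
    rw [map_zero, add_zero]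
    exact (((L.smooth c).contDiffAt ((c.isOpen_domain _).mem_nhds
      (c.jetCoord_mem_domain hy Γ))).differentiableAt (by simp)).hasFDerivAt
  have hσ : HasFDerivAt (fun σ : VertHom n m π y => (((c.total y).1, (c.total y).2,
      c.components y Γ.1 + c.componentsCLM y σ) : JetCoord n m))
      ((0 : VertHom n m π y →L[ℝ] Euc n).prod
        ((0 : VertHom n m π y →L[ℝ] Euc m).prod (c.componentsCLM y))) 0 :=
    (hasFDerivAt_const _ _).prodMk ((hasFDerivAt_const _ _).prodMk
      ((c.componentsCLM y).hasFDerivAt.const_add _))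
  have h := (hl.comp (0 : VertHom n m π y) hσ).smul_const (c.vol (π y))
  rw [momentumCoordCLM_apply, Lagrangian.legendre, hF]
  erw [h.fderiv]
  simp [c.vol_frame hx, componentsCLM_apply, components_vert, dJet]

/-- The coordinate expression `y^i_λ ∘ Ĥ = ∂^i_λ 𝓗` of the Hamiltonian map. -/
theorem components_map (hπ : IsSmoothFiberBundle n m V π) (H : HamiltonianForm n m π) {y : Y}
    (hy : y ∈ c.total.source) (p : LegendreFiber n m π y) (l : Fin n) (i : Fin m) :
    c.components y (H.map hπ y p).1 i l =
      dMom l i (c.hamiltonian H.toFun) (c.momCoord ⟨y, p⟩) := by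
  have hx := c.proj_mem y hy
  have spec := (H.exists_map y p (hπ.nonempty_jetFiber y).some).choose_spec
  -- `Ĥ` is defined with a chosen reference jet `Γ₀`; its value does not enter below.
  change ∀ δ : LegendreFiber n m π y, _ = δ (JetFiber.diff _ (H.map hπ y p)) at spec
  generalize (hπ.nonempty_jetFiber y).some = Γ₀ at spec
  have hF : (fun p' : LegendreFiber n m π y => H.toFun y p' Γ₀) = fun p' =>
      -(c.hamiltonian H.toFun ((c.total y).1, (c.total y).2, c.momentumCoordCLM hy p') •
        c.vol (π y)) + p' (Γ₀.diff (c.jet y hy 0)) := by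
    funext p'
    rw [H.linear_part y p' Γ₀ (c.jet y hy 0), ← c.momCoord_mk hy, c.hamiltonian_momCoord _ hy]
    refine c.topForm_ext hx ?_
    simp [c.vol_frame hx]
  have hl : HasFDerivAt (c.hamiltonian H.toFun)
      (fderiv ℝ (c.hamiltonian H.toFun) (c.momCoord ⟨y, p⟩))
      ((c.total y).1, (c.total y).2, c.momentumCoordCLM hy p) := by
    rw [← c.momCoord_mk hy]
    exact (((H.smooth c).contDiffAt ((c.isOpen_domain _).mem_nhds
      (c.momCoord_mem_domain hy p))).differentiableAt (by simp)).hasFDerivAt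
  have hp : HasFDerivAt (fun p' : LegendreFiber n m π y => (((c.total y).1, (c.total y).2,
      c.momentumCoordCLM hy p') : MomCoord n m))
      ((0 : LegendreFiber n m π y →L[ℝ] Euc n).prod
        ((0 : LegendreFiber n m π y →L[ℝ] Euc m).prod (c.momentumCoordCLM hy))) p :=
    (hasFDerivAt_const _ _).prodMk ((hasFDerivAt_const _ _).prodMk
      (c.momentumCoordCLM hy).hasFDerivAt)
  have h := ((hl.comp p hp).smul_const (c.vol (π y))).neg.add
    (ContinuousLinearMap.apply ℝ (TopForm n) (Γ₀.diff (c.jet y hy 0))).hasFDerivAt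
  -- The momentum `ω ⊗ dy^i ⊗ ∂_λ` picks out the component `Ĥ^i_λ`.
  have s := spec (c.momentum y (Pi.single l (Pi.single i 1)))
  rw [hF] at s
  erw [h.fderiv] at s
  have s' := congrArg (fun α : TopForm n => α (c.frame (π y))) s
  have hmom : ∀ σ : VertHom n m π y,
      c.momentum y (Pi.single l (Pi.single i 1)) σ (c.frame (π y)) = c.components y σ.1 i l := by
    intro σ
    rw [c.momentum_apply_frame hy]
    simp [Pi.single_apply, ite_apply]
  have hd : ∀ Γ Γ' : JetFiber n m π y, c.components y (Γ.diff Γ').1 =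
      c.components y Γ.1 - c.components y Γ'.1 := fun Γ Γ' => c.components_sub y _ _
  simp [c.vol_frame hx, momentumCoordCLM_momentum, hmom, hd, components_jet] at s'
  unfold dMom
  linarith

/-- The coordinate expression `𝓗 = p^λ_i Ĥ^i_λ - 𝓛 ∘ Ĥ` of the relation `H = H_Ĥ + Ĥ^* L`. -/
theorem hamiltonian_eq_of_isAssociated {hπ : IsSmoothFiberBundle n m V π}
    {H : HamiltonianForm n m π} {L : Lagrangian n m π} (hH : H.IsAssociated hπ L)
    {z : MomCoord n m} (hz : z ∈ c.domain (Fin n → Fin m → ℝ)) :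
    c.hamiltonian H.toFun z =
      ∑ l, ∑ i, z.2.2 l i * dMom l i (c.hamiltonian H.toFun) z -
        c.lagrangian L.toFun
          (z.1, z.2.1, fun i l => dMom l i (c.hamiltonian H.toFun) z) := by
  obtain ⟨y, hy, hyz⟩ : ∃ y ∈ c.total.source, c.total y = (z.1, z.2.1) :=
    ⟨_, c.total.map_target hz, c.total.right_inv hz⟩
  have hz' : z = c.momCoord ⟨y, c.momentum y z.2.2⟩ := by
    rw [c.momCoord_mk hy, momentumCoordCLM_momentum, hyz]
  have hφ : (fun i l => dMom l i (c.hamiltonian H.toFun) z) =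
      c.components y (H.map hπ y (c.momentum y z.2.2)).1 := by
    funext i l
    rw [c.components_map hπ H hy, ← hz']
  have h1 := c.hamiltonian_momCoord H.toFun hy (c.momentum y z.2.2)
  have h2 := c.lagrangian_jetCoord L.toFun hy (H.map hπ y (c.momentum y z.2.2))
  simp only [jetCoord, hyz, ← hφ] at h2
  rw [← hz', hH.form_eq, ContinuousAlternatingMap.add_apply, ← h2, formOfMap,
    c.momentum_apply_frame hy] at h1
  have h3 : c.components y ((c.jet y hy 0).diff (H.map hπ y (c.momentum y z.2.2))).1 =
      - fun i l => dMom l i (c.hamiltonian H.toFun) z := by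
    rw [hφ]
    refine (c.components_sub y _ _).trans ?_
    rw [components_jet, zero_sub]
  rw [h3] at h1
  rw [h1]
  simp only [Pi.neg_apply, mul_neg, Finset.sum_neg_distrib]
  ring

end AdaptedChart

/-! ### Partial derivatives -/

theorem fderiv_vertical_eq_sum {f : JetCoord n m → ℝ} (z : JetCoord n m)
    (w : Fin m → Fin n → ℝ) :
    fderiv ℝ f z (0, 0, w) = ∑ l, ∑ i, w i l * dJet l i f z := by
  have hw : ((0, 0, w) : JetCoord n m) =
      ∑ l, ∑ i, w i l • ((0, 0, Pi.single i (Pi.single l 1)) : JetCoord n m) := by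
    refine Prod.ext ?_ (Prod.ext ?_ ?_)
    · simp [Prod.fst_sum]
    · simp [Prod.fst_sum, Prod.snd_sum]
    · funext i l
      simp [Prod.snd_sum, Finset.sum_apply, Pi.single_apply]
  rw [hw]
  simp only [map_sum, map_smul, smul_eq_mul, dJet]

/-- At a point where the momenta are those of the Lagrangian, the derivatives along the fiber
variables drop out of the Legendre transformation `h = p φ - ℓ(x, y, φ)`: there
`∂_i ℓ = - ∂_i h`. -/
theorem dY_lagrangian_eq_neg_dY_hamiltonian {h : MomCoord n m → ℝ} {ℓ : JetCoord n m → ℝ}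
    {φ : MomCoord n m → Fin m → Fin n → ℝ} {z : MomCoord n m}
    (hφ : DifferentiableAt ℝ φ z) (hℓ : DifferentiableAt ℝ ℓ (z.1, z.2.1, φ z))
    (hh : h =ᶠ[nhds z] fun z =>
      ∑ l, ∑ i, z.2.2 l i * φ z i l - ℓ (z.1, z.2.1, φ z))
    (hp : ∀ l i, dJet l i ℓ (z.1, z.2.1, φ z) = z.2.2 l i) (i : Fin m) :
    dY i ℓ (z.1, z.2.1, φ z) = - dY i h z := by
  have hφ' := hφ.hasFDerivAt
  have h1 : ∀ l j, HasFDerivAt (fun z : MomCoord n m => φ z j l)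
      ((ContinuousLinearMap.proj l).comp ((ContinuousLinearMap.proj (R := ℝ)
        (φ := fun _ : Fin m => Fin n → ℝ) j).comp (fderiv ℝ φ z))) z := fun l j =>
    hasFDerivAt_pi'.1 (hasFDerivAt_pi'.1 hφ' j) l
  have h2 : ∀ l j, HasFDerivAt (fun z : MomCoord n m => z.2.2 l j)
      ((ContinuousLinearMap.proj j).comp ((ContinuousLinearMap.proj (R := ℝ)
        (φ := fun _ : Fin n => Fin m → ℝ) l).comp ((ContinuousLinearMap.snd ℝ _ _).comp
          (ContinuousLinearMap.snd ℝ (Euc n) (Euc m × (Fin n → Fin m → ℝ)))))) z := fun l j =>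
    hasFDerivAt_pi'.1 (hasFDerivAt_pi'.1 (hasFDerivAt_snd (p := z)).snd l) j
  have h3 : HasFDerivAt (fun z : MomCoord n m => ((z.1, z.2.1, φ z) : JetCoord n m))
      ((ContinuousLinearMap.fst ℝ _ _).prod (((ContinuousLinearMap.fst ℝ _ _).comp
        (ContinuousLinearMap.snd ℝ (Euc n) (Euc m × (Fin n → Fin m → ℝ)))).prod
          (fderiv ℝ φ z))) z :=
    hasFDerivAt_fst.prodMk ((hasFDerivAt_snd (p := z)).fst.prodMk hφ')
  have h4 := (HasFDerivAt.fun_sum (u := Finset.univ) fun l _ =>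
    HasFDerivAt.fun_sum (u := Finset.univ) fun j _ => (h2 l j).mul (h1 l j)).sub
      (hℓ.hasFDerivAt.comp z h3)
  have h5 := (h4.congr_of_eventuallyEq hh).fderiv
  set w : Fin m → Fin n → ℝ := fderiv ℝ φ z (0, EuclideanSpace.single i 1, 0) with hw
  have h6 : fderiv ℝ ℓ (z.1, z.2.1, φ z) (0, EuclideanSpace.single i 1, w) =
      dY i ℓ (z.1, z.2.1, φ z) + ∑ l, ∑ j, w j l * z.2.2 l j := by
    have : ((0, EuclideanSpace.single i 1, w) : JetCoord n m) =
        (0, EuclideanSpace.single i 1, 0) + (0, 0, w) := by simp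
    rw [this, map_add, fderiv_vertical_eq_sum]
    simp only [hp, dY]
  have h7 : dY i h z = ∑ l, ∑ j, z.2.2 l j * w j l -
      fderiv ℝ ℓ (z.1, z.2.1, φ z) (0, EuclideanSpace.single i 1, w) := by
    unfold dY
    rw [h5]
    simp [hw]
  rw [h7, h6]
  simp only [mul_comm]
  ring

/-! ### Constrained solutions of the Hamilton equations -/

theorem contDiffOn_dJet (c : AdaptedChart n m π) (L : Lagrangian n m π) (l : Fin n) (i : Fin m) :
    ContDiffOn ℝ ∞ (dJet l i (c.lagrangian L.toFun)) (c.domain (Fin m → Fin n → ℝ)) :=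
  ((L.smooth c).fderiv_of_isOpen (c.isOpen_domain _) (by simp)).clm_apply contDiffOn_const

theorem contDiffOn_dMom (c : AdaptedChart n m π) (H : HamiltonianForm n m π) :
    ContDiffOn ℝ ∞ (fun z i l => dMom l i (c.hamiltonian H.toFun) z)
      (c.domain (Fin n → Fin m → ℝ)) :=
  contDiffOn_pi.2 fun _ => contDiffOn_pi.2 fun _ =>
    ((H.smooth c).fderiv_of_isOpen (c.isOpen_domain _) (by simp)).clm_apply contDiffOn_const

/-- `L̂ ∘ Ĥ` is the identity on the constraint space. -/
theorem legendre_map_of_mem_constraintSpace {hπ : IsSmoothFiberBundle n m V π}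
    {H : HamiltonianForm n m π} {L : Lagrangian n m π} (hH : H.IsAssociated hπ L)
    {q : Legendre n m π} (hq : q ∈ L.constraintSpace) :
    L.legendre q.1 (H.map hπ q.1 q.2) = q.2 := by
  obtain ⟨⟨y, Γ⟩, rfl⟩ := hq
  exact hH.legendre_map_legendre y Γ

theorem jetCoord_map (c : AdaptedChart n m π) (hπ : IsSmoothFiberBundle n m V π)
    (H : HamiltonianForm n m π) {q : Legendre n m π} (hq : q.1 ∈ c.total.source) :
    c.jetCoord ⟨q.1, H.map hπ q.1 q.2⟩ = ((c.momCoord q).1, (c.momCoord q).2.1,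
      fun i l => dMom l i (c.hamiltonian H.toFun) (c.momCoord q)) := by
  refine Prod.ext rfl (Prod.ext rfl ?_)
  funext i l
  exact c.components_map hπ H hq q.2 l i

/-- On the constraint space the Lagrangian momenta at `Ĥ(q)` are the coordinates `p^λ_i` of
`q`. -/
theorem dJet_jetCoord_map (c : AdaptedChart n m π) {hπ : IsSmoothFiberBundle n m V π}
    {H : HamiltonianForm n m π} {L : Lagrangian n m π} (hH : H.IsAssociated hπ L)
    {q : Legendre n m π} (hqL : q ∈ L.constraintSpace) (hq : q.1 ∈ c.total.source)
    (l : Fin n) (i : Fin m) :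
    dJet l i (c.lagrangian L.toFun) (c.jetCoord ⟨q.1, H.map hπ q.1 q.2⟩) =
      (c.momCoord q).2.2 l i := by
  rw [← c.momentumCoordCLM_legendre L hq, legendre_map_of_mem_constraintSpace hH hqL]
  exact (congrArg (fun w => w.2.2 l i) (c.momCoord_mk hq q.2)).symm

/-- `∂_i 𝓛 ∘ Ĥ = -∂_i 𝓗` on the constraint space. -/
theorem dY_lagrangian_jetCoord_map (c : AdaptedChart n m π) {hπ : IsSmoothFiberBundle n m V π}
    {H : HamiltonianForm n m π} {L : Lagrangian n m π} (hH : H.IsAssociated hπ L)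
    {q : Legendre n m π} (hqL : q ∈ L.constraintSpace) (hq : q.1 ∈ c.total.source) (i : Fin m) :
    dY i (c.lagrangian L.toFun) (c.jetCoord ⟨q.1, H.map hπ q.1 q.2⟩) =
      - dY i (c.hamiltonian H.toFun) (c.momCoord q) := by
  have hz : c.momCoord q ∈ c.domain (Fin n → Fin m → ℝ) := c.momCoord_mem_domain hq q.2
  have hz' := c.jetCoord_mem_domain hq (H.map hπ q.1 q.2)
  have hp := dJet_jetCoord_map c hH hqL hq
  rw [jetCoord_map c hπ H hq] at hz' hp ⊢
  refine dY_lagrangian_eq_neg_dY_hamiltonian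
    (φ := fun z i l => dMom l i (c.hamiltonian H.toFun) z) ?_ ?_ ?_ hp i
  · exact ((contDiffOn_dMom c H).contDiffAt
      ((c.isOpen_domain _).mem_nhds hz)).differentiableAt (by simp)
  · exact ((L.smooth c).contDiffAt ((c.isOpen_domain _).mem_nhds hz')).differentiableAt (by simp)
  · filter_upwards [(c.isOpen_domain _).mem_nhds hz] with w hw
    exact c.hamiltonian_eq_of_isAssociated hH hw

/-- The chain rule for `f` along a section `u ↦ (u, y(u), w(u))` of jet coordinates. -/
theorem dTotal_eq_dX_comp {f : JetCoord n m → ℝ} {S : Euc n → JetCoord n m} {u : Euc n}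
    (hf : DifferentiableAt ℝ f (S u)) (hS : DifferentiableAt ℝ S u)
    (h1 : (fun v => (S v).1) =ᶠ[nhds u] id) (l : Fin n) :
    dTotal l f (S u) (dX l (fun v => (S v).2.1) u) (dX l (fun v => (S v).2.2) u) =
      dX l (fun v => f (S v)) u := by
  have hS' := hS.hasFDerivAt
  have e1 := hS'.fst.fderiv
  rw [h1.fderiv_eq, fderiv_id] at e1
  have e2 := hS'.snd.fst.fderiv
  have e3 := hS'.snd.snd.fderiv
  have e4 := (hf.hasFDerivAt.comp u hS').fderiv
  change fderiv ℝ (fun v => f (S v)) u = _ at e4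
  unfold dTotal dX
  rw [e2, e3, e4]
  change _ = fderiv ℝ f (S u) (fderiv ℝ S u (EuclideanSpace.single l 1))
  congr 1
  refine Prod.ext ?_ rfl
  exact DFunLike.congr_fun e1 (EuclideanSpace.single l 1)

/-- `Ĥ` takes smooth sections of `Π → X` to smooth sections of `J¹Y → X`. -/
theorem contMDiffOn_jetCoord_map (c : AdaptedChart n m π) (hπ : IsSmoothFiberBundle n m V π)
    (H : HamiltonianForm n m π) {r : X → Legendre n m π} (hr : IsLegendreSection r) :
    ContMDiffOn 𝓘(ℝ, Euc n) 𝓘(ℝ, JetCoord n m) ∞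
      (fun x => c.jetCoord ⟨(r x).1, H.map hπ (r x).1 (r x).2⟩)
      {x | (r x).1 ∈ c.total.source} := by
  have h : ContDiffOn ℝ ∞ (fun z : MomCoord n m => ((z.1, z.2.1,
      fun i l => dMom l i (c.hamiltonian H.toFun) z) : JetCoord n m))
      (c.domain (Fin n → Fin m → ℝ)) :=
    contDiffOn_fst.prodMk ((contDiff_fst.comp contDiff_snd).contDiffOn.prodMk
      (contDiffOn_dMom c H))
  refine (h.contMDiffOn.comp (hr.2 c) fun x hx => c.momCoord_mem_domain hx _).congr ?_
  intro x hx
  exact jetCoord_map c hπ H hx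

section Germ

variable (c : AdaptedChart n m π) {r : X → Legendre n m π} {x : X}

theorem eventually_mem_source (hs : IsSection n m π fun x => (r x).1)
    (hx : (r x).1 ∈ c.total.source) :
    ∀ᶠ u in nhds (c.base x), u ∈ c.base.target ∧ (r (c.base.symm u)).1 ∈ c.total.source := by
  have hxb : x ∈ c.base.source := by
    have := c.proj_mem _ hx
    rwa [hs.2 x] at this
  have ht := c.base.map_source hxb
  refine (c.base.open_target.mem_nhds ht |> Filter.eventually_mem_set.2).and ?_
  have hc : ContinuousAt (fun u => (r (c.base.symm u)).1) (c.base x) := by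
    refine ContinuousAt.comp (g := fun x => (r x).1) hs.1.continuous.continuousAt ?_
    exact c.base.symm.continuousAt ht
  refine hc.eventually_mem (c.total.open_source.mem_nhds ?_)
  rwa [c.base.left_inv hxb]

theorem fst_total_section (hs : IsSection n m π fun x => (r x).1) {u : Euc n}
    (hu : u ∈ c.base.target) (hu' : (r (c.base.symm u)).1 ∈ c.total.source) :
    (c.total (r (c.base.symm u)).1).1 = u := by
  rw [c.fst_total _ hu', hs.2, c.base.right_inv hu]

/-- In coordinates, `Ĥ ∘ r` is the first jet prolongation of the section `π_{ΠY} ∘ r`. -/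
theorem jetCoord_map_section {hπ : IsSmoothFiberBundle n m V π} {H : HamiltonianForm n m π}
    (hr : H.IsHamiltonSolution r) {u : Euc n}
    (hu : u ∈ c.base.target) (hu' : (r (c.base.symm u)).1 ∈ c.total.source) :
    c.jetCoord ⟨(r (c.base.symm u)).1,
        H.map hπ (r (c.base.symm u)).1 (r (c.base.symm u)).2⟩ =
      (u, (c.total (r (c.base.symm u)).1).2,
        fun i l => dX l (fun v => (c.total (r (c.base.symm v)).1).2) u i) := by
  have h := (hr.2 c _ hu').1
  rw [c.base.right_inv hu] at h
  rw [jetCoord_map c hπ H hu']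
  refine Prod.ext (fst_total_section c hr.1.1 hu hu') (Prod.ext rfl ?_)
  funext i l
  exact (h l i).symm

/-- The equation `∂_i 𝓛 = d̂_λ π^λ_i` along `Ĥ ∘ r`. -/
theorem dY_lagrangian_eq_sum_dTotal {hπ : IsSmoothFiberBundle n m V π}
    {H : HamiltonianForm n m π} {L : Lagrangian n m π} (hH : H.IsAssociated hπ L)
    (hr : H.IsHamiltonSolution r) (hrN : ∀ x, r x ∈ L.constraintSpace)
    (hx : (r x).1 ∈ c.total.source) {S : Euc n → JetCoord n m}
    (hS : S = fun u => c.jetCoord ⟨(r (c.base.symm u)).1,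
      H.map hπ (r (c.base.symm u)).1 (r (c.base.symm u)).2⟩) (i : Fin m) :
    dY i (c.lagrangian L.toFun) (S (c.base x)) =
      ∑ l, dTotal l (dJet l i (c.lagrangian L.toFun)) (S (c.base x))
        (dX l (fun u => (S u).2.1) (c.base x)) (dX l (fun u => (S u).2.2) (c.base x)) := by
  have hev := eventually_mem_source c hr.1.1 hx
  obtain ⟨ht, hx'⟩ := hev.self_of_nhds
  have hdom : S (c.base x) ∈ c.domain (Fin m → Fin n → ℝ) := by
    rw [hS]; exact c.jetCoord_mem_domain hx' _
  have hsym : ContMDiffAt 𝓘(ℝ, Euc n) 𝓘(ℝ, Euc n) ∞ c.base.symm (c.base x) :=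
    (contMDiffOn_symm_of_mem_maximalAtlas c.base_mem).contMDiffAt (c.base.open_target.mem_nhds ht)
  have hopen : IsOpen {x | (r x).1 ∈ c.total.source} :=
    c.total.open_source.preimage hr.1.1.1.continuous
  have hSd : DifferentiableAt ℝ S (c.base x) := by
    have h := (contMDiffOn_jetCoord_map c hπ H hr.1).contMDiffAt (hopen.mem_nhds hx')
    have h' := contMDiffAt_iff_contDiffAt.1 (h.comp (c.base x) hsym)
    rw [hS]
    exact h'.differentiableAt (by simp)
  have hmd : DifferentiableAt ℝ (fun u => c.momCoord (r (c.base.symm u))) (c.base x) := by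
    have h := (hr.1.2 c).contMDiffAt (hopen.mem_nhds hx')
    exact (contMDiffAt_iff_contDiffAt.1 (h.comp (c.base x) hsym)).differentiableAt (by simp)
  have hfst : (fun u => (S u).1) =ᶠ[nhds (c.base x)] id := by
    filter_upwards [hev] with u hu
    rw [hS]
    exact fst_total_section c hr.1.1 hu.1 hu.2
  -- The chain rule turns the total derivative into `∂_λ (π^λ_i ∘ Ĥ ∘ r) = ∂_λ r^λ_i`.
  have hterm : ∀ l, dTotal l (dJet l i (c.lagrangian L.toFun)) (S (c.base x))
        (dX l (fun u => (S u).2.1) (c.base x)) (dX l (fun u => (S u).2.2) (c.base x)) =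
      dX l (fun u => (c.momCoord (r (c.base.symm u))).2.2) (c.base x) l i := by
    intro l
    rw [dTotal_eq_dX_comp (((contDiffOn_dJet c L l i).contDiffAt
      ((c.isOpen_domain _).mem_nhds hdom)).differentiableAt (by simp)) hSd hfst]
    have he : (fun u => dJet l i (c.lagrangian L.toFun) (S u)) =ᶠ[nhds (c.base x)]
        fun u => (c.momCoord (r (c.base.symm u))).2.2 l i := by
      filter_upwards [hev] with u hu
      rw [hS]
      exact dJet_jetCoord_map c hH (hrN _) hu.2 l i
    have hm := hmd.hasFDerivAt.snd.snd
    have hm' := (hasFDerivAt_pi'.1 (hasFDerivAt_pi'.1 hm l) i).fderiv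
    unfold dX
    rw [he.fderiv_eq, hm', hm.fderiv]
    rfl
  rw [Finset.sum_congr rfl fun l _ => hterm l]
  refine Eq.trans ?_ ((hr.2 c x hx).2 i).symm
  rw [hS]
  exact dY_lagrangian_jetCoord_map c hH (hrN _) hx' i

end Germ

end Coordinates

end CovariantHamilton

open CovariantHamilton in
theorem mainTheorem1 {n m : ℕ}
    {X : Type*} [TopologicalSpace X] [ChartedSpace (Euc n) X] [IsManifold 𝓘(ℝ, Euc n) ∞ X]
    [T2Space X] [SecondCountableTopology X] [ConnectedSpace X]
    {Y : Type*} [TopologicalSpace Y] [ChartedSpace (Euc n × Euc m) Y]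
    [IsManifold 𝓘(ℝ, Euc n × Euc m) ∞ Y]
    [T2Space Y] [SecondCountableTopology Y] [ConnectedSpace Y]
    {V : Type*} [TopologicalSpace V] [ChartedSpace (Euc m) V] [IsManifold 𝓘(ℝ, Euc m) ∞ V]
    (π : Y → X) (hπ : IsSmoothFiberBundle n m V π)
    (L : Lagrangian n m π) (hL : L.IsSemiregular)
    (H : HamiltonianForm n m π) (hH : H.IsAssociated hπ L)
    (r : X → Legendre n m π) (hr : H.IsHamiltonSolution r)
    (hrN : ∀ x, r x ∈ L.constraintSpace) :
    L.IsEulerLagrangeSolution (fun x => (r x).1) ∧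
      L.IsCartanSolution (fun x => ⟨(r x).1, H.map hπ (r x).1 (r x).2⟩) := by
  refine ⟨⟨hr.1.1, fun c x hx => ?_⟩,
    ⟨hr.1.1, fun c => contMDiffOn_jetCoord_map c hπ H hr.1⟩, fun c x hx => ?_⟩
  · intro y y' u₀ z i
    have hS : (fun u => c.jetCoord ⟨(r (c.base.symm u)).1,
        H.map hπ (r (c.base.symm u)).1 (r (c.base.symm u)).2⟩) =ᶠ[nhds u₀]
          fun u => (u, y u, y' u) := by
      filter_upwards [eventually_mem_source c hr.1.1 hx] with u hu
      exact jetCoord_map_section c hr hu.1 hu.2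
    have hy' : (fun u => (c.jetCoord ⟨(r (c.base.symm u)).1,
        H.map hπ (r (c.base.symm u)).1 (r (c.base.symm u)).2⟩).2.2) =ᶠ[nhds u₀] y' :=
      hS.fun_comp fun w => w.2.2
    have h := dY_lagrangian_eq_sum_dTotal c hH hr hrN hx rfl i
    -- The fiber coordinates of `Ĥ ∘ r` are `∂_λ s^i` near `u₀`, so their derivatives agree as well.
    have hz := hS.eq_of_nhds
    simp only [dX] at h
    rw [hy'.fderiv_eq] at h
    rw [hz] at h
    rw [sub_eq_zero]
    exact h
  · intro ζ u₀ z yh yy P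
    -- `Ĥ ∘ r` is holonomic, so every term with a factor `ŷ^j_μ - y^j_μ` vanishes.
    have hz : z = (u₀, (c.total (r (c.base.symm u₀)).1).2, fun i l => yh l i) := by
      obtain ⟨h1, h2⟩ := (eventually_mem_source c hr.1.1 hx).self_of_nhds
      exact jetCoord_map_section c hr h1 h2
    have hyh : ∀ k j, yh k j - z.2.2 j k = 0 := fun k j => by
      rw [hz]; exact sub_self _
    refine ⟨fun l i => by simp [hyh], fun i => ?_⟩
    simp only [hyh, zero_mul, Finset.sum_const_zero, add_zero]
    rw [sub_eq_zero]
    exact dY_lagrangian_eq_sum_dTotal c hH hr hrN hx rfl i
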